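/- Let $d \ge 2$ and let $c > 0$ be constants. Consider instances $(G,\psi)$ where $G=(V,E)$ is a finite simple connected $d$-regular graph and $\psi\colon E \to \{0,\dots,d-1\}$ is a proper edge $d$-colouring. A *sinkless colouring* of $(G,\psi)$ is a map $\varphi\colon V\to\{0,\dots,d-1\}$ such that no edge $e=\{u,v\}\in E$ has $\varphi(u)=\psi(e)=\varphi(v)$. In the randomised LOCAL model all nodes of $G$ execute the same algorithm; initially each node $v$ knows $n=|V|$, $d$, the colours of its incident edges, and a random number $x(v)$, where the $x(v)$, $v\in V$, are independent and uniform in $[0,1]$. In each synchronous round every node sends a message of unbounded size to each neighbour, receives a message from each neighbour, and performs unrestricted local computation. A *Monte Carlo algorithm* with running time $T\colon\mathbb N\to\mathbb N$ is such an algorithm in which every node of an $n$-node instance announces its output (here $\varphi(v)$, which is required to be a random variable) after exactly $T(n)$ rounds. Then there is no Monte Carlo algorithm with running time $T(n) = o(\log\log n)$ that, for all sufficiently large $n$ and every instance $(G,\psi)$ with $n$ nodes, outputs a sinkless colouring of $(G,\psi)$ with probability at least $1 - 1/n^c$. -/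

import Mathlib

open MeasureTheory Filter Asymptotics

/-- A problem instance on the node set `V`: a simple connected `d`-regular graph together with a
proper edge `d`-colouring, that is, a proper node colouring of the line graph. -/
structure ColouredRegularGraph (d : ℕ) (V : Type) where
  graph : SimpleGraph V
  [locallyFinite : graph.LocallyFinite]
  connected : graph.Connected
  regular : graph.IsRegularOfDegree d
  edgeColouring : graph.lineGraph.Coloring (Fin d)

namespace ColouredRegularGraph

variable {d : ℕ} {V : Type}

/-- The colour `ψ({u, v})` of the edge `{u, v}`. -/
def colour (G : ColouredRegularGraph d V) {u v : V} (h : G.graph.Adj u v) : Fin d :=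
  G.edgeColouring ⟨s(u, v), h⟩

theorem colour_symm (G : ColouredRegularGraph d V) {u v : V} (h : G.graph.Adj u v) :
    G.colour h.symm = G.colour h := by
  unfold colour
  congr 2
  exact Sym2.eq_swap

/-- Distinct edges at the same node have distinct colours. -/
theorem eq_of_colour_eq (G : ColouredRegularGraph d V) {u v w : V} (hv : G.graph.Adj u v)
    (hw : G.graph.Adj u w) (h : G.colour hv = G.colour hw) : v = w := by
  by_contra hne
  refine G.edgeColouring.valid (v := ⟨s(u, v), hv⟩) (w := ⟨s(u, w), hw⟩) ?_ h
  rw [SimpleGraph.lineGraph_adj_iff_exists]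
  refine ⟨fun he => hne ?_, u, by simp, by simp⟩
  exact Sym2.congr_right.1 (congrArg Subtype.val he)

/-- Every node has exactly one neighbour along an edge of a given colour. -/
theorem existsUnique_neighbour (G : ColouredRegularGraph d V) (v : V) (c : Fin d) :
    ∃! w, ∃ h : G.graph.Adj v w, G.colour h = c := by
  letI := G.locallyFinite
  let f : G.graph.neighborSet v → Fin d := fun w => G.colour w.2
  have hinj : Function.Injective f := fun a b hab =>
    Subtype.ext (G.eq_of_colour_eq a.2 b.2 hab)
  have hcard : Fintype.card (G.graph.neighborSet v) = Fintype.card (Fin d) := by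
    rw [SimpleGraph.card_neighborSet_eq_degree, Fintype.card_fin]
    exact G.regular v
  obtain ⟨w, hw⟩ := ((Fintype.bijective_iff_injective_and_card f).2 ⟨hinj, hcard⟩).2 c
  refine ⟨w, ⟨w.2, hw⟩, ?_⟩
  rintro w' ⟨h', hc'⟩
  exact G.eq_of_colour_eq h' w.2 (hc'.trans hw.symm)

/-- The neighbour of `v` along its edge of colour `c`. -/
noncomputable def neighbour (G : ColouredRegularGraph d V) (v : V) (c : Fin d) : V :=
  (G.existsUnique_neighbour v c).choose

theorem neighbour_spec (G : ColouredRegularGraph d V) (v : V) (c : Fin d) :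
    ∃ h : G.graph.Adj v (G.neighbour v c), G.colour h = c :=
  (G.existsUnique_neighbour v c).choose_spec.1

/-- `φ` is a sinkless colouring: there is no edge `e = {u, v}` with `φ u = φ v = ψ(e)`. -/
def IsSinklessColouring (G : ColouredRegularGraph d V) (φ : V → Fin d) : Prop :=
  ∀ (u v : V) (h : G.graph.Adj u v), φ u = G.colour h → φ v ≠ G.colour h

end ColouredRegularGraph

/-- A randomised algorithm of the `LOCAL` model on edge-`d`-coloured `d`-regular graphs, whose nodes
output a colour. All nodes run the same program. The degree `d` is known to every node. Each node
has exactly one incident edge of each colour, so a node addresses its incident edges by their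
colours. The sets of states and messages are arbitrary and local computation is unrestricted. -/
structure LocalAlgorithm (d : ℕ) where
  State : Type
  Message : Type
  /-- The initial state, from the number of nodes `n` and the node's own random number. -/
  init : ℕ → unitInterval → State
  /-- The message sent along the incident edge of the given colour. -/
  send : State → Fin d → Message
  /-- The new state, from the old one and the messages received along the incident edges. -/
  receive : State → (Fin d → Message) → State
  output : State → Fin d

namespace LocalAlgorithm

variable {d : ℕ} {V : Type} [Fintype V]

/-- The state of each node after `t` synchronous rounds on `G`, when node `v` is given the random
number `x v`. -/
noncomputable def stateAfter (A : LocalAlgorithm d) (G : ColouredRegularGraph d V)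
    (x : V → unitInterval) : ℕ → V → A.State
  | 0, v => A.init (Fintype.card V) (x v)
  | t + 1, v => A.receive (A.stateAfter G x t v)
      (fun c => A.send (A.stateAfter G x t (G.neighbour v c)) c)

/-- The colours announced by the nodes after `t` rounds. -/
noncomputable def run (A : LocalAlgorithm d) (t : ℕ) (G : ColouredRegularGraph d V)
    (x : V → unitInterval) (v : V) : Fin d :=
  A.output (A.stateAfter G x t v)

end LocalAlgorithm

/-- A Monte Carlo algorithm: a randomised algorithm that stops after `time n` rounds, a
deterministic function of the number of nodes `n`, and whose outputs are random variables. -/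
structure MonteCarloAlgorithm (d : ℕ) extends LocalAlgorithm d where
  time : ℕ → ℕ
  measurable_run : ∀ (V : Type) [Fintype V] (G : ColouredRegularGraph d V) (v : V),
    Measurable fun x : V → unitInterval => toLocalAlgorithm.run (time (Fintype.card V)) G x v

namespace MonteCarloAlgorithm

variable {d : ℕ} {V : Type} [Fintype V]

/-- The probability that `A` outputs a sinkless colouring of `G`, when the nodes are given
independent random numbers, uniform in `[0, 1]`. -/
noncomputable def successProbability (A : MonteCarloAlgorithm d) (G : ColouredRegularGraph d V) :
    ℝ :=
  (Measure.pi fun _ : V => (volume : Measure unitInterval)).real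
    {x | G.IsSinklessColouring (A.run (A.time (Fintype.card V)) G x)}

/-- `A` solves sinkless colouring with probability at least `1 - 1 / n ^ c` on every instance with
`n` nodes, for all sufficiently large `n`. -/
def SolvesSinklessColouring (A : MonteCarloAlgorithm d) (c : ℝ) : Prop :=
  ∀ᶠ n : ℕ in atTop, ∀ (V : Type) [Fintype V] (G : ColouredRegularGraph d V),
    Fintype.card V = n → 1 - 1 / (n : ℝ) ^ c ≤ A.successProbability G

end MonteCarloAlgorithm

/-! The proof is by round elimination. On a Cayley graph of involutions, left translations preserve
edge colours, so an algorithm is one function `f` of the random numbers, read from the root, and the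
output across the edge of colour `c` is `f (x ∘ σ c)`, with `σ c` left multiplication by `γ c`. If
reduced words are free beyond length `t`, the root sees a tree.

If every colour has conflict probability at most `a ^ (3 * (d + 1))`, then conditioning on what both
ends of an edge see yields edge orientations for which the root is a sink with probability at most
`2 * d * a ^ (d + 1)` (`exists_orientation`). Conditioning these on the smaller ball yields a
colouring using one round less, with conflict probability at most `6 * d * a` (`exists_colouring`).
After `t` eliminations the ends of an edge choose independently, and some colour has probability at
least `1 / d`. Hence some conflict probability exceeds `(6d)⁻¹` to a power exponential in `t`
(`exists_conflict_probability_gt`), which beats `n ^ (-c)` when `t = o(log log n)`.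

Suitable groups act on a truncated tree of depth `R`; their order is at most doubly exponential in
`R`, so `log log n = O(R)` and `t < R` (`exists_group_freeUpTo`). -/

open scoped ENNReal

/-! ### Conditioning and independence in product measures. -/

section Resampling

variable {V I : Type} [Fintype V] [MeasurableSpace I]

open Classical in
/-- Keeping the coordinates in `S` and resampling the others independently preserves a product
measure. -/
theorem measurePreserving_piecewise (ν : Measure I) [IsProbabilityMeasure ν] (S : Set V) :
    MeasurePreserving (fun z : (V → I) × (V → I) => S.piecewise z.1 z.2)
      ((Measure.pi fun _ => ν).prod (Measure.pi fun _ => ν)) (Measure.pi fun _ => ν) := by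
  have hm : Measurable (fun z : (V → I) × (V → I) => S.piecewise z.1 z.2) := by
    refine measurable_pi_lambda _ fun i => ?_
    by_cases hi : i ∈ S
    · simp only [Set.piecewise_eq_of_mem _ _ _ hi]; fun_prop
    · simp only [Set.piecewise_eq_of_notMem _ _ _ hi]; fun_prop
  refine ⟨hm, (Measure.pi_eq fun s hs => ?_).symm⟩
  rw [Measure.map_apply hm (MeasurableSet.univ_pi hs)]
  have : (fun z : (V → I) × (V → I) => S.piecewise z.1 z.2) ⁻¹' Set.univ.pi s
      = (Set.univ.pi fun i => if i ∈ S then s i else Set.univ) ×ˢ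
        (Set.univ.pi fun i => if i ∈ S then Set.univ else s i) := by
    ext z
    simp only [Set.mem_preimage, Set.mem_univ_pi, Set.mem_prod, ← forall_and]
    refine forall_congr' fun i => ?_
    by_cases hi : i ∈ S <;> simp [hi]
  rw [this, Measure.prod_prod, Measure.pi_pi, Measure.pi_pi, ← Finset.prod_mul_distrib]
  refine Finset.prod_congr rfl fun i _ => ?_
  by_cases hi : i ∈ S <;> simp [hi]

open Classical in
/-- The conditional probability of the event `E` given the coordinates in `S`. -/
noncomputable def condProb (ν : Measure I) (S : Set V) (E : Set (V → I)) (x : V → I) : ℝ≥0∞ :=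
  Measure.pi (fun _ => ν) {y | S.piecewise x y ∈ E}

theorem dependsOn_condProb (ν : Measure I) (S : Set V) (E : Set (V → I)) :
    DependsOn (condProb ν S E) S := by
  classical
  intro x y h
  have : ∀ z, S.piecewise x z = S.piecewise y z := fun z => funext fun i => by
    by_cases hi : i ∈ S <;> simp [hi, h]
  simp only [condProb, this]

variable {ν : Measure I} [IsProbabilityMeasure ν] {S T : Set V} {E F : Set (V → I)}

theorem measurable_condProb (hE : MeasurableSet E) : Measurable (condProb ν S E) :=
  measurable_measure_prodMk_left ((measurePreserving_piecewise ν S).measurable hE)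

/-- The law of total probability. -/
theorem setLIntegral_condProb (hE : MeasurableSet E) (hF : MeasurableSet F)
    (hFS : DependsOn (· ∈ F) S) :
    ∫⁻ x in F, condProb ν S E x ∂Measure.pi (fun _ => ν) = Measure.pi (fun _ => ν) (F ∩ E) := by
  classical
  rw [← (measurePreserving_piecewise ν S).measure_preimage (hF.inter hE).nullMeasurableSet,
    Measure.prod_apply ((measurePreserving_piecewise ν S).measurable (hF.inter hE)),
    ← lintegral_indicator hF]
  refine lintegral_congr fun x => ?_
  have key : ∀ y, (S.piecewise x y ∈ F) = (x ∈ F) := fun y =>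
    hFS fun i hi => by simp [hi]
  by_cases hx : x ∈ F
  · simp [hx, condProb, Set.preimage, key]
  · simp [hx, Set.preimage, key]

theorem lintegral_condProb (hE : MeasurableSet E) :
    ∫⁻ x, condProb ν S E x ∂Measure.pi (fun _ => ν) = Measure.pi (fun _ => ν) E := by
  simpa using setLIntegral_condProb (ν := ν) (S := S) (F := Set.univ) hE .univ
    (fun _ _ _ => by simp)

/-- Events that depend on disjoint sets of coordinates are independent. -/
theorem pi_inter_eq_mul (hE : MeasurableSet E) (hF : MeasurableSet F)
    (hES : DependsOn (· ∈ E) S) (hFT : DependsOn (· ∈ F) T) (hST : Disjoint S T) :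
    Measure.pi (fun _ : V => ν) (E ∩ F)
      = Measure.pi (fun _ => ν) E * Measure.pi (fun _ => ν) F := by
  classical
  rw [← Measure.prod_prod,
    ← (measurePreserving_piecewise ν S).measure_preimage (hE.inter hF).nullMeasurableSet]
  congr 1
  ext ⟨x, y⟩
  have h1 : (S.piecewise x y ∈ E) = (x ∈ E) := hES fun i hi => by simp [hi]
  have h2 : (S.piecewise x y ∈ F) = (y ∈ F) := hFT fun i hi => by
    simp [Set.disjoint_right.1 hST hi]
  simp [h1, h2]

theorem pi_biInter_eq_prod {ι : Type} (s : Finset ι) {E : ι → Set (V → I)} {T : ι → Set V}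
    (hE : ∀ i, MeasurableSet (E i)) (hET : ∀ i, DependsOn (· ∈ E i) (T i))
    (hT : Pairwise fun i j => Disjoint (T i) (T j)) :
    Measure.pi (fun _ : V => ν) (⋂ i ∈ s, E i) = ∏ i ∈ s, Measure.pi (fun _ => ν) (E i) := by
  classical
  induction s using Finset.induction_on with
  | empty => simp
  | insert i s hi ih =>
    rw [Finset.prod_insert hi, ← ih, Finset.set_biInter_insert]
    refine pi_inter_eq_mul (S := T i) (T := ⋃ j ∈ s, T j) (hE i)
      (s.measurableSet_biInter fun j _ => hE j) (hET i) ?_ ?_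
    · intro x y h
      simp only [Set.mem_iInter, eq_iff_iff]
      refine forall₂_congr fun j hj => iff_of_eq (hET j fun v hv => h v ?_)
      exact Set.mem_biUnion (show j ∈ (s : Set ι) from hj) hv
    · simp only [Set.disjoint_iUnion_right]
      intro j hj
      exact hT (by rintro rfl; exact hi hj)

/-- Events whose sets of coordinates meet only inside `S` are conditionally independent given the
coordinates in `S`. -/
theorem condProb_iInter {ι : Type} [Fintype ι] {E : ι → Set (V → I)} {T : ι → Set V}
    (hE : ∀ i, MeasurableSet (E i)) (hET : ∀ i, DependsOn (· ∈ E i) (T i))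
    (hT : ∀ i j, i ≠ j → T i ∩ T j ⊆ S) (x : V → I) :
    condProb ν S (⋂ i, E i) x = ∏ i, condProb ν S (E i) x := by
  classical
  unfold condProb
  refine Eq.trans ?_ (pi_biInter_eq_prod Finset.univ (T := fun i => T i \ S) ?_ ?_ ?_)
  · simp [Set.ofPred_forall]
  · exact fun i => (measurePreserving_piecewise ν S).measurable.comp measurable_prodMk_left (hE i)
  · intro i y z h
    refine hET i fun v hv => ?_
    by_cases hvS : v ∈ S
    · simp [hvS]
    · simp [hvS, h v ⟨hv, hvS⟩]
  · intro i j hij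
    rw [Set.disjoint_left]
    exact fun v hi hj => hi.2 (hT i j hij ⟨hi.1, hj.1⟩)

theorem condProb_inter {T' : Set V} (hE : MeasurableSet E) (hF : MeasurableSet F)
    (hET : DependsOn (· ∈ E) T) (hFT : DependsOn (· ∈ F) T') (hT : T ∩ T' ⊆ S) (x : V → I) :
    condProb ν S (E ∩ F) x = condProb ν S E x * condProb ν S F x := by
  have := condProb_iInter (ν := ν) (S := S) (E := fun b => cond b E F)
    (T := fun b => cond b T T') (by simp [hE, hF]) (by simp [hET, hFT])
    (by
      rintro (_ | _) (_ | _) h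
      · exact absurd rfl h
      · simpa [Set.inter_comm] using hT
      · simpa using hT
      · exact absurd rfl h) x
  have hEF : E ∩ F = ⋂ b : Bool, cond b E F := by
    ext; simp [and_comm]
  simpa [hEF] using this

theorem measurePreserving_comp_involutive {σ : V → V} (hσ : Function.Involutive σ) :
    MeasurePreserving (fun x : V → I => x ∘ σ) (Measure.pi fun _ => ν) (Measure.pi fun _ => ν) := by
  convert measurePreserving_piCongrLeft (fun _ : V => ν) hσ.toPerm using 1
  ext x i
  have := Equiv.piCongrLeft_apply_apply (P := fun _ : V => I) (hσ.toPerm) x (σ i)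
  simp only [Function.Involutive.coe_toPerm, hσ i] at this
  exact this.symm

/-- Moving the root along an edge preserves both the measure and the common view `S`, so the
neighbour's conditional probability is the root's own, evaluated at `x ∘ σ`. -/
theorem condProb_comp_involutive {σ : V → V} (hσ : Function.Involutive σ)
    (hS : ∀ v, σ v ∈ S ↔ v ∈ S) (hE : MeasurableSet E) (x : V → I) :
    condProb ν S E (x ∘ σ) = condProb ν S ((fun x => x ∘ σ) ⁻¹' E) x := by
  classical
  unfold condProb
  have hm : MeasurableSet {y | S.piecewise (x ∘ σ) y ∈ E} :=
    ((measurePreserving_piecewise ν S).measurable.comp measurable_prodMk_left) hE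
  rw [← (measurePreserving_comp_involutive (ν := ν) hσ).measure_preimage hm.nullMeasurableSet]
  congr 1
  ext y
  simp only [Set.mem_preimage, Set.mem_ofPred_eq]
  refine iff_of_eq (congrArg (· ∈ E) (funext fun v => ?_))
  by_cases hv : v ∈ S <;> simp [hv, hS]

end Resampling

/-! ### Round elimination. -/

section RoundElimination

variable {V I : Type} [Fintype V] [MeasurableSpace I] {ν : Measure I} [IsProbabilityMeasure ν]
  {d : ℕ} {σ : Fin d → V → V} {B B' : Set V} {a : ℝ≥0∞}

/-- From a colouring `f` of the root that depends on `B` to orientations of the edges at the root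
that depend on what both endpoints see; `x ∈ D c` means that the edge of colour `c` may be
directed towards the root. -/
theorem exists_orientation (hσ : ∀ c, Function.Involutive (σ c)) (ha : a ≠ 0) (ha' : a ≠ ⊤)
    {f : (V → I) → Fin d} (hf : Measurable f) (hfB : DependsOn f B)
    (hp : ∀ c, Measure.pi (fun _ => ν) {x | f x = c ∧ f (x ∘ σ c) = c} ≤ a ^ (3 * (d + 1))) :
    ∃ D : Fin d → Set (V → I), (∀ c, MeasurableSet (D c)) ∧
      (∀ c, DependsOn (· ∈ D c) (B ∩ σ c ⁻¹' B)) ∧ (∀ c x, x ∈ D c ∨ x ∘ σ c ∈ D c) ∧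
      Measure.pi (fun _ => ν) (⋂ c, D c) ≤ 2 * d * a ^ (d + 1) := by
  set μ := Measure.pi (fun _ : V => ν)
  -- The conflict bound is `K ^ 3`: Markov's inequality costs `K ^ 2` here, and `exists_colouring`
  -- later divides the remaining `K` by `a ^ d`.
  set K := a ^ (d + 1) with hK
  have hK0 : K ≠ 0 := pow_ne_zero _ ha
  have hK' : K ≠ ⊤ := ENNReal.pow_ne_top ha'
  set F : Fin d → Set (V → I) := fun c => {x | f x = c}
  have hF : ∀ c, MeasurableSet (F c) := fun c => hf (measurableSet_singleton c)
  set S : Fin d → Set V := fun c => B ∩ σ c ⁻¹' B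
  have hS : ∀ c v, σ c v ∈ S c ↔ v ∈ S c := fun c v => by
    simp [S, hσ c v, and_comm]
  set u : Fin d → (V → I) → ℝ≥0∞ := fun c => condProb ν (S c) (F c)
  have hu : ∀ c, Measurable (u c) := fun c => measurable_condProb (hF c)
  have hshift : ∀ c, MeasurePreserving (fun x : V → I => x ∘ σ c) μ μ := fun c =>
    measurePreserving_comp_involutive (hσ c)
  have hus : ∀ c, Measurable (fun x => u c (x ∘ σ c)) := fun c =>
    (hu c).comp (hshift c).measurable
  have hdep : ∀ c ⦃x y : V → I⦄, (∀ v ∈ S c, x v = y v) → u c x = u c y := fun c =>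
    dependsOn_condProb ν (S c) (F c)
  have hdep' : ∀ c ⦃x y : V → I⦄, (∀ v ∈ S c, x v = y v) → u c (x ∘ σ c) = u c (y ∘ σ c) :=
    fun c x y h => hdep c fun v hv => h _ ((hS c v).2 hv)
  have hFB : ∀ c, DependsOn (· ∈ F c) B := fun c x y h => by simp [F, hfB h]
  have hone : ∀ c, μ (F c ∩ {x | u c x < K}) ≤ K := fun c => by
    have hm : MeasurableSet {x | u c x < K} := measurableSet_lt (hu c) measurable_const
    rw [Set.inter_comm, ← setLIntegral_condProb (S := S c) (hF c) hm
      (fun x y h => by simp [hdep c h])]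
    calc ∫⁻ x in {x | u c x < K}, u c x ∂μ ≤ ∫⁻ _ in {x | u c x < K}, K ∂μ :=
          setLIntegral_mono measurable_const fun x hx => le_of_lt hx
      _ ≤ K := by simpa using mul_le_of_le_one_right' prob_le_one
  -- Given the common view, the two ends choose independently. If both like `c`, they conflict with
  -- conditional probability at least `K * K`.
  have htwo : ∀ c, μ {x | K ≤ u c x ∧ K ≤ u c (x ∘ σ c)} ≤ K := fun c => by
    set G : Set (V → I) := (fun x => x ∘ σ c) ⁻¹' F c
    have hG : MeasurableSet G := (hshift c).measurable (hF c)
    have hGB : DependsOn (· ∈ G) (σ c ⁻¹' B) := fun x y h => hFB c fun v hv =>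
      h _ (by simpa [hσ c v] using hv)
    have h1 : ∀ x, condProb ν (S c) (F c ∩ G) x = u c x * u c (x ∘ σ c) := fun x => by
      rw [condProb_inter (hF c) hG (hFB c) hGB subset_rfl,
        ← condProb_comp_involutive (hσ c) (hS c) (hF c)]
    have h2 : K * K * μ {x | K ≤ u c x ∧ K ≤ u c (x ∘ σ c)} ≤ K * K * K := by
      calc _ ≤ K * K * μ {x | K * K ≤ condProb ν (S c) (F c ∩ G) x} := by
            gcongr
            rintro ⟨h, h'⟩
            rw [h1]
            exact mul_le_mul' h h'
        _ ≤ ∫⁻ x, condProb ν (S c) (F c ∩ G) x ∂μ :=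
            mul_meas_ge_le_lintegral (measurable_condProb ((hF c).inter hG)) _
        _ = μ (F c ∩ G) := lintegral_condProb ((hF c).inter hG)
        _ ≤ a ^ (3 * (d + 1)) := hp c
        _ = K * K * K := by rw [hK]; ring
    exact (ENNReal.mul_le_mul_iff_right (mul_ne_zero hK0 hK0) (ENNReal.mul_ne_top hK' hK')).1 h2
  refine ⟨fun c => {x | u c x < K} ∪ {x | K ≤ u c (x ∘ σ c)}, fun c => ?_, fun c x y h => ?_,
    fun c x => ?_, ?_⟩
  · exact (measurableSet_lt (hu c) measurable_const).union
      (measurableSet_le measurable_const (hus c))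
  · simp [hdep c h, hdep' c h]
  · rcases lt_or_ge (u c x) K with h | h
    · exact Or.inl (Or.inl h)
    · refine Or.inr (Or.inr ?_)
      have : (x ∘ σ c) ∘ σ c = x := funext fun v => congrArg x (hσ c v)
      simpa [this] using h
  · calc _ ≤ μ (⋃ c, ((F c ∩ {x | u c x < K}) ∪ {x | K ≤ u c x ∧ K ≤ u c (x ∘ σ c)})) := by
          -- At a sink, look at the edge whose colour the root itself chose: either that choice was
          -- unlikely, or both ends were likely to make it.
          refine measure_mono fun x hx => Set.mem_iUnion.2 ⟨f x, ?_⟩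
          rcases lt_or_ge (u (f x) x) K with h | h
          · exact Or.inl ⟨rfl, h⟩
          · exact Or.inr ⟨h, (Set.mem_iInter.1 hx (f x)).resolve_left (not_lt.2 h)⟩
      _ ≤ ∑ c : Fin d, μ ((F c ∩ {x | u c x < K}) ∪ {x | K ≤ u c x ∧ K ≤ u c (x ∘ σ c)}) :=
          measure_iUnion_fintype_le _ _
      _ ≤ ∑ c : Fin d, (K + K) := Finset.sum_le_sum fun c _ =>
          (measure_union_le _ _).trans (add_le_add (hone c) (htwo c))
      _ = _ := by simp; ring

/-- From orientations of the edges at the root to a colouring of the root that depends only on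
`B'`. -/
theorem exists_colouring (hd : 0 < d) (hσ : ∀ c, Function.Involutive (σ c)) (ha : a ≠ 0)
    (ha' : a ≠ ⊤)
    (hB : ∀ c c', c ≠ c' → ∀ v ∈ B, σ c v ∈ B → σ c' v ∈ B → v ∈ B')
    {D : Fin d → Set (V → I)} (hD : ∀ c, MeasurableSet (D c))
    (hDB : ∀ c, DependsOn (· ∈ D c) (B ∩ σ c ⁻¹' B)) (hDD : ∀ c x, x ∈ D c ∨ x ∘ σ c ∈ D c)
    (hp : Measure.pi (fun _ => ν) (⋂ c, D c) ≤ 2 * d * a ^ (d + 1)) :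
    ∃ f : (V → I) → Fin d, Measurable f ∧ DependsOn f B' ∧
      ∀ c, Measure.pi (fun _ => ν) {x | f x = c ∧ f (x ∘ σ c) = c} ≤ 6 * d * a := by
  classical
  set μ := Measure.pi (fun _ : V => ν)
  set r : Fin d → (V → I) → ℝ≥0∞ := fun c => condProb ν B' (D c)
  have hr : ∀ c, Measurable (r c) := fun c => measurable_condProb (hD c)
  have hdep : ∀ c ⦃x y : V → I⦄, (∀ v ∈ B', x v = y v) → r c x = r c y := fun c =>
    dependsOn_condProb ν B' (D c)
  have hshift : ∀ c, MeasurePreserving (fun x : V → I => x ∘ σ c) μ μ := fun c =>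
    measurePreserving_comp_involutive (hσ c)
  set P : (V → I) → Finset (Fin d) := fun x => {c | r c x ≤ a} with hPdef
  set N : Set (V → I) := {x | ∀ c, a < r c x}
  have hNm : MeasurableSet N := by
    simp only [N, Set.ofPred_forall]
    exact MeasurableSet.iInter fun c => measurableSet_lt measurable_const (hr c)
  -- Given `B'`, the orientations are independent, so on `N` a sink has conditional probability at
  -- least `a ^ d`; then Markov's inequality applies.
  have hN : μ N ≤ 2 * d * a := by
    have h1 : ∀ x, condProb ν B' (⋂ c, D c) x = ∏ c, r c x := condProb_iInter hD hDB
      fun c c' hcc v hv => hB c c' hcc v hv.1.1 hv.1.2 hv.2.2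
    have h2 : a ^ d * μ N ≤ a ^ d * (2 * d * a) := by
      calc _ ≤ a ^ d * μ {x | a ^ d ≤ condProb ν B' (⋂ c, D c) x} := by
            gcongr
            intro x hx
            simp only [Set.mem_ofPred_eq, h1]
            simpa using Finset.prod_le_prod' (s := Finset.univ) fun c _ => (hx c).le
        _ ≤ ∫⁻ x, condProb ν B' (⋂ c, D c) x ∂μ :=
            mul_meas_ge_le_lintegral (measurable_condProb (MeasurableSet.iInter hD)) _
        _ = μ (⋂ c, D c) := lintegral_condProb (MeasurableSet.iInter hD)
        _ ≤ _ := hp.trans_eq (by ring)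
    exact (ENNReal.mul_le_mul_iff_right (pow_ne_zero _ ha) (ENNReal.pow_ne_top ha')).1 h2
  have hsmall : ∀ c, μ ({x | r c x ≤ a} ∩ D c) ≤ a := fun c => by
    rw [← setLIntegral_condProb (S := B') (hD c) (measurableSet_le (hr c) measurable_const)
      (fun x y h => by simp [hdep c h])]
    calc ∫⁻ x in {x | r c x ≤ a}, r c x ∂μ ≤ ∫⁻ _ in {x | r c x ≤ a}, a ∂μ :=
          setLIntegral_mono measurable_const fun x hx => hx
      _ ≤ a := by simpa using mul_le_of_le_one_right' prob_le_one
  have hP : Measurable P := by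
    refine measurable_to_countable' fun s => ?_
    have : P ⁻¹' {s} = ⋂ c, {x | r c x ≤ a ↔ c ∈ s} := by
      ext x
      simp [hPdef, Finset.ext_iff]
    rw [this]
    exact MeasurableSet.iInter fun c =>
      (measurableSet_le (hr c) measurable_const).iff (MeasurableSet.const _)
  -- The root picks an edge unlikely to point towards it. The default colour is used only on `N`.
  set g : Finset (Fin d) → Fin d := fun s => if h : s.Nonempty then h.choose else ⟨0, hd⟩
  have hg : ∀ x, x ∉ N → r (g (P x)) x ≤ a := fun x hx => by
    have hne : (P x).Nonempty := by
      simp only [N, Set.mem_ofPred_eq, not_forall, not_lt] at hx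
      obtain ⟨c, hc⟩ := hx
      exact ⟨c, by simpa [hPdef] using hc⟩
    have := hne.choose_spec
    simp only [g, hne, dif_pos]
    simpa [hPdef] using this
  refine ⟨fun x => g (P x), (measurable_of_finite g).comp hP, fun x y h => ?_, fun c => ?_⟩
  · simp [hPdef, hdep _ h]
  · set Q : Set (V → I) := N ∪ ({x | r c x ≤ a} ∩ D c)
    have hQm : MeasurableSet Q :=
      hNm.union ((measurableSet_le (hr c) measurable_const).inter (hD c))
    have hQ : μ Q ≤ 2 * d * a + a := (measure_union_le _ _).trans (add_le_add hN (hsmall c))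
    have hsub : ∀ x, g (P x) = c → x ∈ D c → x ∈ Q := fun x hx hxD => by
      by_cases hxN : x ∈ N
      · exact Or.inl hxN
      · exact Or.inr ⟨hx ▸ hg x hxN, hxD⟩
    -- In a conflict both ends pick the edge, yet it may point towards one of them, and that end
    -- lies in its bad set `Q`.
    calc _ ≤ μ (Q ∪ (fun x => x ∘ σ c) ⁻¹' Q) := measure_mono fun x hx =>
          (hDD c x).imp (hsub x hx.1) (hsub (x ∘ σ c) hx.2)
      _ ≤ (2 * d * a + a) + (2 * d * a + a) := by
          refine (measure_union_le _ _).trans (add_le_add hQ ?_)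
          rwa [(hshift c).measure_preimage hQm.nullMeasurableSet]
      _ = (4 * d + 2 * 1) * a := by ring
      _ ≤ (4 * d + 2 * d) * a := by
          gcongr
          exact_mod_cast hd
      _ = 6 * d * a := by ring

/-- A colouring of the root that depends only on its `t`-ball has, for some colour `c`, a
substantial probability of conflicting along the edge of colour `c`. -/
theorem exists_conflict_probability_gt (hd : 2 ≤ d) (hσ : ∀ c, Function.Involutive (σ c))
    (B : ℕ → Set V) (hB₀ : ∀ c, ∀ v ∈ B 0, σ c v ∉ B 0) (t : ℕ)
    (hB : ∀ k < t, ∀ c c', c ≠ c' → ∀ v ∈ B (k + 1), σ c v ∈ B (k + 1) →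
      σ c' v ∈ B (k + 1) → v ∈ B k)
    {f : (V → I) → Fin d} (hf : Measurable f) (hfB : DependsOn f (B t)) :
    ∃ c, (6 * d : ℝ≥0∞)⁻¹ ^ ((3 * (d + 1) + 1) ^ (t + 1)) <
      Measure.pi (fun _ => ν) {x | f x = c ∧ f (x ∘ σ c) = c} := by
  have hd0 : (6 * d : ℝ≥0∞) ≠ 0 := by simp; omega
  have hd1 : (6 * d : ℝ≥0∞) ≠ ⊤ := ENNReal.mul_ne_top (by simp) (by simp)
  set b : ℝ≥0∞ := (6 * d : ℝ≥0∞)⁻¹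
  set m := 3 * (d + 1)
  have hb0 : b ≠ 0 := ENNReal.inv_ne_zero.2 hd1
  have hb1 : b ≠ ⊤ := ENNReal.inv_ne_top.2 hd0
  have hble : b ≤ 1 := by
    rw [ENNReal.inv_le_one]
    norm_cast
    omega
  -- An explicit `m`-th power is the form that `exists_orientation` takes as input.
  suffices H : ∃ c, (b ^ ((m + 1) ^ t)) ^ m <
      Measure.pi (fun _ => ν) {x | f x = c ∧ f (x ∘ σ c) = c} by
    obtain ⟨c, hc⟩ := H
    refine ⟨c, lt_of_le_of_lt ?_ hc⟩
    rw [← pow_mul]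
    refine pow_le_pow_right_of_le_one' hble ?_
    rw [pow_succ]
    gcongr
    omega
  induction t generalizing f with
  | zero =>
    by_contra! hcon
    have key : ∀ c, Measure.pi (fun _ => ν) {x | f x = c} ≤ b := fun c => by
      have hm : MeasurableSet {x | f x = c} := hf (measurableSet_singleton c)
      have hs := measurePreserving_comp_involutive (ν := ν) (hσ c)
      have hmul := pi_inter_eq_mul (ν := ν) (S := B 0) (T := σ c ⁻¹' B 0) hm
        (hs.measurable hm) (fun x y h => by simp [hfB h])
        (fun x y h => by
          simp [hfB (x := x ∘ σ c) (y := y ∘ σ c) fun v hv => h _ (by simpa [hσ c v] using hv)])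
        (Set.disjoint_left.2 fun v hv => hB₀ c v hv)
      rw [hs.measure_preimage hm.nullMeasurableSet] at hmul
      have h2 := hmul.symm.trans_le (hcon c)
      rw [← sq] at h2
      refine (ENNReal.pow_le_pow_left_iff two_ne_zero).1 (h2.trans ?_)
      simp only [pow_zero, pow_one]
      exact pow_le_pow_right_of_le_one' hble (by omega)
    have htot : (1 : ℝ≥0∞) ≤ d * b := by
      calc (1 : ℝ≥0∞) = Measure.pi (fun _ => ν) (⋃ c, {x | f x = c}) := by
            rw [← measure_univ (μ := Measure.pi fun _ : V => ν)]
            congr 1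
            ext x
            simp
        _ ≤ ∑ c : Fin d, Measure.pi (fun _ => ν) {x | f x = c} := measure_iUnion_fintype_le _ _
        _ ≤ ∑ c : Fin d, b := Finset.sum_le_sum fun c _ => key c
        _ = d * b := by simp
    have h6 : (6 : ℝ≥0∞) ≤ 1 := by
      calc (6 : ℝ≥0∞) ≤ 6 * (d * b) := le_mul_of_one_le_right' htot
        _ = 6 * d * b := by ring
        _ = 1 := ENNReal.mul_inv_cancel hd0 hd1
    norm_num at h6
  | succ t ih =>
    by_contra! hcon
    set a := b ^ ((m + 1) ^ (t + 1)) with hadef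
    have ha : a ≠ 0 := pow_ne_zero _ hb0
    have ha' : a ≠ ⊤ := ENNReal.pow_ne_top hb1
    obtain ⟨D, hD, hDB, hDD, hDp⟩ := exists_orientation hσ ha ha' hf hfB hcon
    obtain ⟨f', hf', hfB', hp'⟩ := exists_colouring (by omega) hσ ha ha'
      (hB t (by omega)) hD hDB hDD hDp
    obtain ⟨c, hc⟩ := ih (fun k hk => hB k (by omega)) hf' hfB'
    refine absurd (hc.trans_le (hp' c)) (not_lt.2 ?_)
    -- Growth by `m + 1` rather than `m` leaves a spare factor at most `b`, which absorbs `6 * d`.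
    have : a = (b ^ ((m + 1) ^ t)) ^ m * b ^ ((m + 1) ^ t) := by
      rw [hadef, pow_succ (m + 1) t, pow_mul, pow_succ]
    calc 6 * d * a ≤ 6 * d * ((b ^ ((m + 1) ^ t)) ^ m * b) := by
          rw [this]
          gcongr
          simpa using pow_le_pow_right_of_le_one' hble (Nat.one_le_pow t (m + 1) (by omega))
      _ = (6 * d * b) * (b ^ ((m + 1) ^ t)) ^ m := by ring
      _ = _ := by rw [ENNReal.mul_inv_cancel hd0 hd1, one_mul]

end RoundElimination

/-! ### Cayley graphs of involutions and their balls. -/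

section CayleyInstance

variable {d : ℕ} {Γ : Type} [Group Γ]

/-- The evaluations of reduced words of length at most `t` in the generators `γ`. -/
def wordBall (γ : Fin d → Γ) (t : ℕ) : Set Γ :=
  {g | ∃ u : List (Fin d), u.IsChain (· ≠ ·) ∧ u.length ≤ t ∧ (u.map γ).prod = g}

variable {γ : Fin d → Γ}

theorem one_mem_wordBall (t : ℕ) : (1 : Γ) ∈ wordBall γ t := ⟨[], by simp⟩

theorem wordBall_mono {s t : ℕ} (h : s ≤ t) : wordBall γ s ⊆ wordBall γ t :=
  fun _ ⟨u, hu, hl, hg⟩ => ⟨u, hu, hl.trans h, hg⟩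

theorem mul_mem_wordBall (hγ : ∀ c, γ c * γ c = 1) {t : ℕ} {g : Γ} (hg : g ∈ wordBall γ t)
    (c : Fin d) : γ c * g ∈ wordBall γ (t + 1) := by
  obtain ⟨u, hu, hl, rfl⟩ := hg
  match u with
  | [] => exact ⟨[c], by simp⟩
  | b :: v =>
    by_cases h : c = b
    · subst h
      refine ⟨v, hu.tail, ?_, ?_⟩
      · simp at hl; omega
      · simp [← mul_assoc, hγ]
    · exact ⟨c :: b :: v, hu.cons_cons h, by simpa using hl, by simp⟩

/-- `γ` generates freely up to length `R`: reduced words of length at most `R` have distinct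
values. -/
def FreeUpTo (γ : Fin d → Γ) (R : ℕ) : Prop :=
  ∀ u v : List (Fin d), u.IsChain (· ≠ ·) → v.IsChain (· ≠ ·) → u.length ≤ R → v.length ≤ R →
    (u.map γ).prod = (v.map γ).prod → u = v

namespace FreeUpTo

variable {R : ℕ}

theorem ne_one (h : FreeUpTo γ R) (hR : 1 ≤ R) (c : Fin d) : γ c ≠ 1 := fun hc => by
  simpa using h [c] [] (by simp) (by simp) (by simpa) (by simp) (by simpa)

theorem injective (h : FreeUpTo γ R) (hR : 1 ≤ R) : Function.Injective γ := fun c c' hc => by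
  simpa using h [c] [c'] (by simp) (by simp) (by simpa) (by simpa) (by simpa)

/-- A reduced word whose length does not grow when multiplied by `γ c` starts with `c`. -/
theorem head?_eq (h : FreeUpTo γ R) {t : ℕ} (ht : t + 1 ≤ R) {u : List (Fin d)}
    (hu : u.IsChain (· ≠ ·)) (hl : u.length = t) {c : Fin d}
    (hc : γ c * (u.map γ).prod ∈ wordBall γ t) : u.head? = some c := by
  obtain ⟨v, hv, hvl, hvg⟩ := hc
  match u with
  | [] =>
    have := h v [c] hv (by simp) (by omega) (by simp; omega) (by simpa using hvg)
    subst this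
    simp at hvl hl
    omega
  | b :: w =>
    by_contra hb
    have hcb : c ≠ b := fun e => hb (by simp [e])
    have := h v (c :: b :: w) hv (hu.cons_cons hcb) (by omega)
      (by simp at hl ⊢; omega) (by simpa using hvg)
    subst this
    simp at hvl hl
    omega

/-- On the sphere of radius `k + 1`, only the first letter of the reduced word leads to no greater
length. Freeness up to `k + 2` covers the words lengthened by one letter. -/
theorem mem_wordBall (h : FreeUpTo γ R) {k : ℕ} (hk : k + 2 ≤ R) {c c' : Fin d} (hcc : c ≠ c')
    {g : Γ} (hg : g ∈ wordBall γ (k + 1)) (hc : γ c * g ∈ wordBall γ (k + 1))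
    (hc' : γ c' * g ∈ wordBall γ (k + 1)) : g ∈ wordBall γ k := by
  obtain ⟨u, hu, hl, rfl⟩ := hg
  by_cases hlk : u.length ≤ k
  · exact ⟨u, hu, hlk, rfl⟩
  · have hl' : u.length = k + 1 := by omega
    exact absurd (Option.some.inj
      ((h.head?_eq hk hu hl' hc).symm.trans (h.head?_eq hk hu hl' hc'))) hcc

theorem notMem_wordBall_zero (h : FreeUpTo γ R) (hR : 1 ≤ R) (c : Fin d) {g : Γ}
    (hg : g ∈ wordBall γ 0) : γ c * g ∉ wordBall γ 0 := fun hc => by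
  obtain ⟨u, hu, hl, rfl⟩ := hg
  have hu0 : u = [] := by simpa using hl
  simpa [hu0] using h.head?_eq hR hu (by simp [hu0]) hc

end FreeUpTo

/-- The Cayley graph of `Γ` with respect to the involutions `γ`, whose edge `{g, g * γ c}` has the
colour `c`. -/
noncomputable def cayleyInstance (γ : Fin d → Γ) (hγ : ∀ c, γ c * γ c = 1)
    (hinj : Function.Injective γ) (hne : ∀ c, γ c ≠ 1)
    (hgen : Subgroup.closure (Set.range γ) = ⊤) : ColouredRegularGraph d Γ :=
  let graph : SimpleGraph Γ :=
    { Adj := fun g h => ∃ c, h = g * γ c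
      symm := ⟨fun g h ⟨c, hc⟩ => ⟨c, by simp [hc, mul_assoc, hγ]⟩⟩
      loopless := ⟨fun g ⟨c, hc⟩ => hne c (by simpa using hc)⟩ }
  let e : ∀ g, Fin d ≃ graph.neighborSet g := fun g =>
    Equiv.ofBijective (fun c => ⟨g * γ c, c, rfl⟩)
      ⟨fun c c' h => hinj (mul_left_cancel (congrArg Subtype.val h)), fun ⟨h, c, hc⟩ => ⟨c, Subtype.ext hc.symm⟩⟩
  letI : graph.LocallyFinite := fun g => Fintype.ofEquiv _ (e g)
  have hcol : ∀ x : graph.edgeSet, ∃ c, ∀ g h, s(g, h) = x.1 → h = g * γ c := by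
    rintro ⟨x, hx⟩
    induction x with | _ g h
    obtain ⟨c, hc⟩ := hx
    refine ⟨c, fun g' h' he => ?_⟩
    rcases Sym2.eq_iff.1 he with ⟨rfl, rfl⟩ | ⟨rfl, rfl⟩
    · exact hc
    · have hc' : g' = h' * γ c := hc
      rw [hc', mul_assoc, hγ, mul_one]
  { graph := graph
    connected := by
      refine ⟨fun g h => ?_⟩
      have key : ∀ k : Γ, graph.Reachable g (g * k) := fun k => by
        have hk : k ∈ Subgroup.closure (Set.range γ) := hgen ▸ Subgroup.mem_top k
        have step : ∀ (x : Γ) c, graph.Reachable x (x * γ c) := fun x c =>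
          SimpleGraph.Adj.reachable ⟨c, rfl⟩
        induction hk using Subgroup.closure_induction_right with
        | one => simp
        | mul_right x y _ hy ih =>
          obtain ⟨c, rfl⟩ := hy
          simpa [mul_assoc] using ih.trans (step (g * x) c)
        | mul_inv_cancel x y _ hy ih =>
          obtain ⟨c, rfl⟩ := hy
          rw [inv_eq_of_mul_eq_one_left (hγ c)]
          simpa [mul_assoc] using ih.trans (step (g * x) c)
      simpa using key (g⁻¹ * h)
    regular := fun g => by
      rw [← SimpleGraph.card_neighborSet_eq_degree, Fintype.card_congr (e g).symm,
        Fintype.card_fin]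
    edgeColouring := SimpleGraph.Coloring.mk (fun x => (hcol x).choose) fun {x y} hxy => by
      intro heq
      rw [SimpleGraph.lineGraph_adj_iff_exists] at hxy
      obtain ⟨hne', g, hgx, hgy⟩ := hxy
      obtain ⟨h, hh⟩ := Sym2.mem_iff_exists.1 hgx
      obtain ⟨h', hh'⟩ := Sym2.mem_iff_exists.1 hgy
      refine hne' (Subtype.ext ?_)
      rw [hh, hh', (hcol x).choose_spec g h hh.symm, (hcol y).choose_spec g h' hh'.symm, heq] }

section

variable (hγ : ∀ c, γ c * γ c = 1) (hinj : Function.Injective γ) (hne : ∀ c, γ c ≠ 1)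
  (hgen : Subgroup.closure (Set.range γ) = ⊤)

theorem cayleyInstance_adj (g : Γ) (c : Fin d) :
    (cayleyInstance γ hγ hinj hne hgen).graph.Adj g (g * γ c) := ⟨c, rfl⟩

theorem cayleyInstance_colour {g h : Γ}
    (hadj : (cayleyInstance γ hγ hinj hne hgen).graph.Adj g h) :
    h = g * γ ((cayleyInstance γ hγ hinj hne hgen).colour hadj) :=
  Exists.choose_spec (p := fun c => ∀ g' h', s(g', h') = s(g, h) → h' = g' * γ c) _ g h rfl

theorem cayleyInstance_neighbour (g : Γ) (c : Fin d) :
    (cayleyInstance γ hγ hinj hne hgen).neighbour g c = g * γ c := by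
  obtain ⟨h, hc⟩ := (cayleyInstance γ hγ hinj hne hgen).neighbour_spec g c
  have := cayleyInstance_colour hγ hinj hne hgen h
  rwa [hc] at this

variable [Fintype Γ]

/-- Edges are right multiplications, so left translations are colour-preserving automorphisms. -/
theorem stateAfter_cayleyInstance_mul (A : LocalAlgorithm d) (x : Γ → unitInterval) (k : Γ)
    (t : ℕ) (g : Γ) :
    A.stateAfter (cayleyInstance γ hγ hinj hne hgen) (fun h => x (k * h)) t g
      = A.stateAfter (cayleyInstance γ hγ hinj hne hgen) x t (k * g) := by
  induction t generalizing g with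
  | zero => rfl
  | succ t ih => simp [LocalAlgorithm.stateAfter, ih, cayleyInstance_neighbour, mul_assoc]

theorem stateAfter_cayleyInstance_congr (A : LocalAlgorithm d) {x y : Γ → unitInterval} (t : ℕ)
    (g : Γ) (h : ∀ k ∈ wordBall γ t, x (g * k) = y (g * k)) :
    A.stateAfter (cayleyInstance γ hγ hinj hne hgen) x t g
      = A.stateAfter (cayleyInstance γ hγ hinj hne hgen) y t g := by
  induction t generalizing g with
  | zero =>
    have := h 1 (one_mem_wordBall 0)
    simp only [mul_one] at this
    simp [LocalAlgorithm.stateAfter, this]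
  | succ t ih =>
    simp only [LocalAlgorithm.stateAfter, cayleyInstance_neighbour]
    rw [ih g fun k hk => h k (wordBall_mono t.le_succ hk)]
    congr 1
    funext c
    rw [ih (g * γ c) fun k hk => by
      simpa [mul_assoc] using h (γ c * k) (mul_mem_wordBall hγ hk c)]

end

end CayleyInstance

/-! ### Finite groups acting on a truncated tree. -/

section TruncatedTree

variable {d : ℕ}

/-- The reduced words of length at most `R`. -/
abbrev ReducedWord (d R : ℕ) : Type :=
  {u : List (Fin d) // u.IsChain (· ≠ ·) ∧ u.length ≤ R}

theorem ReducedWord.getElem?_injective (d R : ℕ) :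
    Function.Injective fun (u : ReducedWord d R) (i : Fin R) => u.1[i.1]? := by
  intro u v h
  refine Subtype.ext (List.ext_getElem? fun i => ?_)
  by_cases hi : i < R
  · exact congrFun h ⟨i, hi⟩
  · rw [List.getElem?_eq_none (u.2.2.trans (not_lt.1 hi)),
      List.getElem?_eq_none (v.2.2.trans (not_lt.1 hi))]

instance (d R : ℕ) : Finite (ReducedWord d R) :=
  Finite.of_injective _ (ReducedWord.getElem?_injective d R)

theorem ReducedWord.card_le (d R : ℕ) : Nat.card (ReducedWord d R) ≤ (d + 1) ^ R := by
  simpa using Nat.card_le_card_of_injective _ (ReducedWord.getElem?_injective d R)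

/-- Multiplication by the letter `c` on reduced words of length at most `R`; words that would
become too long are fixed. -/
def ReducedWord.letter (R : ℕ) (c : Fin d) (u : ReducedWord d R) : ReducedWord d R :=
  if hc : u.1.head? = some c then ⟨u.1.tail, u.2.1.tail, by simp; have := u.2.2; omega⟩
  else if hl : u.1.length < R then
    ⟨c :: u.1, List.isChain_cons.2 ⟨fun b hb e => hc (by rw [e]; exact hb), u.2.1⟩, by
      simpa using hl⟩
  else u

theorem ReducedWord.letter_involutive (R : ℕ) (c : Fin d) :
    Function.Involutive (ReducedWord.letter R c) := by
  rintro ⟨u, hu, hl⟩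
  by_cases hc : u.head? = some c
  · match u with
    | b :: v =>
      obtain rfl : b = c := by simpa using hc
      have hv : v.head? ≠ some b := fun e => (List.isChain_cons.1 hu).1 b e rfl
      have : v.length < R := by simpa using hl
      simp [ReducedWord.letter, hv, this]
  · by_cases hlt : u.length < R <;> simp [ReducedWord.letter, hc, hlt]

/-- The permutation of the reduced words given by the letter `c`. -/
def ReducedWord.perm (R : ℕ) (c : Fin d) : Equiv.Perm (ReducedWord d R) :=
  (ReducedWord.letter_involutive R c).toPerm

/-- Applied to the empty word, a reduced word spells itself without reaching the truncation.
Distinct words therefore give distinct permutations. -/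
theorem ReducedWord.prod_perm_apply_nil (R : ℕ) (u : List (Fin d)) (hu : u.IsChain (· ≠ ·))
    (hl : u.length ≤ R) :
    (u.map (ReducedWord.perm R)).prod ⟨[], by simp⟩ = ⟨u, hu, hl⟩ := by
  induction u with
  | nil => rfl
  | cons c u ih =>
    have hl' : u.length < R := by simpa using hl
    have hc : u.head? ≠ some c := fun e => (List.isChain_cons.1 hu).1 c e rfl
    rw [List.map_cons, List.prod_cons, Equiv.Perm.mul_apply, ih hu.tail hl'.le]
    simp [ReducedWord.perm, ReducedWord.letter, hc, hl']

/-- One word of each length below `R` gives `R` distinct group elements, so the order can be made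
arbitrarily large. -/
theorem exists_reduced_of_length (hd : 2 ≤ d) (k : ℕ) :
    ∃ u : List (Fin d), u.IsChain (· ≠ ·) ∧ u.length = k := by
  have : Nontrivial (Fin d) := Fin.nontrivial_iff_two_le.2 hd
  induction k with
  | zero => exact ⟨[], by simp⟩
  | succ k ih =>
    obtain ⟨u, hu, hl⟩ := ih
    match u with
    | [] => exact ⟨[⟨0, by omega⟩], by simp, by simp at hl ⊢; omega⟩
    | b :: v =>
      obtain ⟨c, hc⟩ := exists_ne b
      exact ⟨c :: b :: v, hu.cons_cons hc, by simpa using hl⟩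

/-- There are finite groups generated by `d` involutions freely up to length `R`, of at most doubly
exponential order. -/
theorem exists_group_freeUpTo (hd : 2 ≤ d) (R : ℕ) :
    ∃ (Γ : Type) (_ : Group Γ) (_ : Fintype Γ) (γ : Fin d → Γ), (∀ c, γ c * γ c = 1) ∧
      Subgroup.closure (Set.range γ) = ⊤ ∧ FreeUpTo γ R ∧ R ≤ Fintype.card Γ ∧
      Fintype.card Γ ≤ ((d + 1) ^ R).factorial := by
  classical
  let H : Subgroup (Equiv.Perm (ReducedWord d R)) :=
    Subgroup.closure (Set.range (ReducedWord.perm R))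
  let γ : Fin d → H := fun c => ⟨ReducedWord.perm R c, Subgroup.subset_closure ⟨c, rfl⟩⟩
  have hfree : FreeUpTo γ R := fun u v hu hv hul hvl h => by
    have h' : (u.map (ReducedWord.perm R)).prod = (v.map (ReducedWord.perm R)).prod := by
      simpa [γ, Function.comp_def] using congrArg (Subtype.val : H → _) h
    have := ReducedWord.prod_perm_apply_nil R u hu hul
    rw [h', ReducedWord.prod_perm_apply_nil R v hv hvl] at this
    exact (congrArg Subtype.val this).symm
  let _ : Fintype H := Fintype.ofFinite H
  refine ⟨H, inferInstance, inferInstance, γ, fun c => ?_, ?_, hfree, ?_, ?_⟩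
  · exact Subtype.ext (Equiv.ext fun u => ReducedWord.letter_involutive R c u)
  · rw [← Subgroup.closure_closure_coe_preimage (k := Set.range (ReducedWord.perm (d := d) R))]
    congr 1
    ext ⟨p, hp⟩
    simp [γ, Subtype.ext_iff]
  · choose w hw hwl using exists_reduced_of_length hd
    have : Function.Injective fun i : Fin R => ((w i).map γ).prod := fun i j h => by
      have := hfree _ _ (hw i) (hw j) (by rw [hwl]; omega) (by rw [hwl]; omega) h
      exact Fin.ext (by rw [← hwl i, ← hwl j, this])
    simpa using Fintype.card_le_of_injective _ this
  · rw [← Nat.card_eq_fintype_card]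
    calc Nat.card H ≤ Nat.card (Equiv.Perm (ReducedWord d R)) :=
          Nat.card_le_card_of_injective _ Subtype.val_injective
      _ = (Nat.card (ReducedWord d R)).factorial := Nat.card_perm
      _ ≤ _ := Nat.factorial_le (ReducedWord.card_le d R)

end TruncatedTree

/-! ### Conflict probability against polynomially small failure. -/

/-- On the Cayley graph of a group that is free up to length greater than its running time, a
Monte Carlo algorithm fails with substantial probability. -/
theorem successProbability_cayleyInstance_lt {d : ℕ} (hd : 2 ≤ d) {Γ : Type} [Group Γ]
    [Fintype Γ] {γ : Fin d → Γ} (hγ : ∀ c, γ c * γ c = 1) (hinj : Function.Injective γ)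
    (hne : ∀ c, γ c ≠ 1) (hgen : Subgroup.closure (Set.range γ) = ⊤) {R : ℕ}
    (hfree : FreeUpTo γ R) (A : MonteCarloAlgorithm d)
    (hR : A.time (Fintype.card Γ) + 1 ≤ R) :
    A.successProbability (cayleyInstance γ hγ hinj hne hgen) <
      1 - (6 * d : ℝ)⁻¹ ^ ((3 * (d + 1) + 1) ^ (A.time (Fintype.card Γ) + 1)) := by
  set G := cayleyInstance γ hγ hinj hne hgen
  set t := A.time (Fintype.card Γ)
  set μ := Measure.pi fun _ : Γ => (volume : Measure unitInterval)
  have hf : ∀ v, Measurable fun x : Γ → unitInterval => A.run t G x v := A.measurable_run Γ G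
  have hσ : ∀ c, Function.Involutive fun g => γ c * g := fun c g => by simp [← mul_assoc, hγ]
  have hdep : DependsOn (fun x : Γ → unitInterval => A.run t G x 1) (wordBall γ t) := by
    intro x y h
    refine congrArg A.output
      (stateAfter_cayleyInstance_congr hγ hinj hne hgen A.toLocalAlgorithm t 1 fun k hk => ?_)
    rw [one_mul]
    exact h k hk
  obtain ⟨c, hc⟩ := exists_conflict_probability_gt (ν := (volume : Measure unitInterval)) hd hσ
    (wordBall γ) (fun c g hg => hfree.notMem_wordBall_zero (by omega) c hg) t
    (fun k hk c c' hcc g hg h h' => hfree.mem_wordBall (by omega) hcc hg h h') (hf 1)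
    hdep
  set C : Set (Γ → unitInterval) := {x | A.run t G x 1 = c ∧ A.run t G (x ∘ (γ c * ·)) 1 = c}
  have hrun : ∀ x : Γ → unitInterval,
      A.run t G (x ∘ (γ c * ·)) 1 = A.run t G x (γ c) := fun x => by
    have := stateAfter_cayleyInstance_mul hγ hinj hne hgen A.toLocalAlgorithm x (γ c) t 1
    rw [mul_one] at this
    exact congrArg A.output this
  have hCm : MeasurableSet C := by
    simp only [C, hrun]
    exact (hf 1 (measurableSet_singleton c)).inter (hf (γ c) (measurableSet_singleton c))
  have hsub : {x | G.IsSinklessColouring (A.run t G x)} ⊆ Cᶜ := fun x hx hxC => by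
    have hadj : G.graph.Adj 1 (γ c) := by
      simpa using cayleyInstance_adj hγ hinj hne hgen 1 c
    have hcol : G.colour hadj = c := hinj (by
      simpa using (cayleyInstance_colour hγ hinj hne hgen hadj).symm)
    have h1 := hx 1 (γ c) hadj
    rw [hcol] at h1
    exact h1 hxC.1 (hrun x ▸ hxC.2)
  have hle : A.successProbability G ≤ 1 - μ.real C := by
    rw [← probReal_compl_eq_one_sub hCm]
    exact measureReal_mono hsub
  have hlt := (ENNReal.toReal_lt_toReal (ENNReal.pow_ne_top (ENNReal.inv_ne_top.2 (by
    simp; omega))) (measure_ne_top _ _)).2 hc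
  simp only [ENNReal.toReal_pow, ENNReal.toReal_inv, ENNReal.toReal_mul, ENNReal.toReal_ofNat,
    ENNReal.toReal_natCast] at hlt
  exact hle.trans_lt (sub_lt_sub_left hlt 1)

theorem log_log_factorial_pow_le {b R : ℕ} (hb : 1 ≤ b) :
    Real.log (Real.log ((b ^ R).factorial : ℕ)) ≤ 2 * R * Real.log b := by
  set N := b ^ R with hN
  have hN1 : 1 ≤ N := Nat.one_le_pow _ _ hb
  have hNR : (1 : ℝ) ≤ N := by exact_mod_cast hN1
  have h1 : Real.log (N.factorial : ℕ) ≤ (N : ℝ) ^ 2 := by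
    calc Real.log (N.factorial : ℕ) ≤ Real.log ((N : ℝ) ^ N) :=
          Real.log_le_log (by positivity) (by exact_mod_cast N.factorial_le_pow)
      _ = N * Real.log N := Real.log_pow _ _
      _ ≤ N * N := by
          gcongr
          exact Real.log_le_self (by positivity)
      _ = (N : ℝ) ^ 2 := by ring
  have h2 : 2 * R * Real.log b = Real.log ((N : ℝ) ^ 2) := by
    rw [Real.log_pow, hN, Nat.cast_pow, Real.log_pow]
    push_cast
    ring
  rw [h2]
  have h0 : 0 ≤ Real.log (N.factorial : ℕ) :=
    Real.log_nonneg (by exact_mod_cast N.factorial_pos)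
  -- If the factorial is `1`, the outer logarithm is `Real.log 0 = 0`.
  rcases h0.eq_or_lt with h | h
  · rw [← h, Real.log_zero]
    exact Real.log_nonneg (one_le_pow₀ hNR)
  · exact Real.log_le_log h h1

/-- A polynomially small failure probability is eventually smaller than the bound given by
`o(log log n)` rounds of round elimination. -/
theorem eventually_one_div_rpow_le {T : ℕ → ℕ} {c : ℝ} (hc : 0 < c) {m b : ℝ} (hm : 1 < m)
    (hb : 1 < b)
    (hT : ∀ᶠ n : ℕ in atTop, T n * Real.log m ≤ Real.log (Real.log n) / 4) :
    ∀ᶠ n : ℕ in atTop, ∀ M : ℕ, (M : ℝ) = m ^ (T n + 1) → 1 / (n : ℝ) ^ c ≤ b⁻¹ ^ M := by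
  have hlog : Tendsto (fun n : ℕ => Real.log n) atTop atTop :=
    Real.tendsto_log_atTop.comp tendsto_natCast_atTop_atTop
  have hexp : Tendsto (fun n : ℕ => Real.exp (3 / 4 * Real.log (Real.log n))) atTop atTop :=
    Real.tendsto_exp_atTop.comp
      ((Real.tendsto_log_atTop.comp hlog).const_mul_atTop (by norm_num))
  filter_upwards [hT, hlog.eventually_gt_atTop 0, eventually_gt_atTop 0,
    hexp.eventually_ge_atTop (m * Real.log b / c)] with n hTn hln hn hbig M hM
  have hn' : (0 : ℝ) < n := by exact_mod_cast hn
  have hb0 : 0 < b := by linarith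
  set z := Real.log (Real.log n)
  -- The factor `(log n) ^ (1 / 4)` pays for the rounds, `(log n) ^ (3 / 4)` for the constants.
  have hz : Real.log n = Real.exp (3 / 4 * z) * Real.exp (z / 4) := by
    rw [← Real.exp_add, ← Real.exp_log hln]
    congr 1
    ring
  have hpow : m ^ (T n + 1) ≤ m * Real.exp (z / 4) := by
    rw [pow_succ, mul_comm]
    gcongr
    calc m ^ T n = Real.exp (T n * Real.log m) := by
          rw [mul_comm, Real.exp_mul, Real.exp_log (by linarith), Real.rpow_natCast]
      _ ≤ _ := Real.exp_le_exp.2 hTn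
  have hmain : M * Real.log b ≤ c * Real.log n := by
    calc M * Real.log b ≤ m * Real.exp (z / 4) * Real.log b := by
          rw [hM]
          gcongr
          exact Real.log_nonneg hb.le
      _ = (m * Real.log b / c) * (c * Real.exp (z / 4)) := by field_simp
      _ ≤ Real.exp (3 / 4 * z) * (c * Real.exp (z / 4)) := by gcongr
      _ = c * Real.log n := by rw [hz]; ring
  rw [inv_pow, one_div]
  refine inv_anti₀ (by positivity) ?_
  rw [← Real.log_le_log_iff (by positivity) (by positivity), Real.log_pow, Real.log_rpow hn']
  exact hmain

theorem mainTheorem2 (d : ℕ) (hd : 2 ≤ d) (c : ℝ) (hc : 0 < c) :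
    ¬ ∃ A : MonteCarloAlgorithm d, A.SolvesSinklessColouring c ∧
      (fun n : ℕ => (A.time n : ℝ)) =o[atTop] (fun n : ℕ => Real.log (Real.log n)) := by
  rintro ⟨A, hA, ho⟩
  have hd' : (2 : ℝ) ≤ d := by exact_mod_cast hd
  set m : ℝ := 3 * (d + 1) + 1 with hm
  have hm1 : 1 < m := by linarith
  have hlm : 0 < Real.log m := Real.log_pos hm1
  have hloglog : Tendsto (fun n : ℕ => Real.log (Real.log n)) atTop atTop :=
    Real.tendsto_log_atTop.comp (Real.tendsto_log_atTop.comp tendsto_natCast_atTop_atTop)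
  have hT : ∀ᶠ n : ℕ in atTop, A.time n * Real.log m ≤ Real.log (Real.log n) / 4 := by
    filter_upwards [ho.def (c := 1 / (4 * Real.log m)) (by positivity),
      hloglog.eventually_ge_atTop 0] with n hn hn0
    rw [Real.norm_of_nonneg (Nat.cast_nonneg _), Real.norm_of_nonneg hn0] at hn
    calc A.time n * Real.log m
        ≤ 1 / (4 * Real.log m) * Real.log (Real.log n) * Real.log m := by gcongr
      _ = Real.log (Real.log n) / 4 := by field_simp
  obtain ⟨n₀, hn₀⟩ := eventually_atTop.1 ((hA.and hT).and
    ((eventually_one_div_rpow_le hc hm1 (b := 6 * d) (by linarith) hT).and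
      (eventually_ge_atTop 3)))
  -- Since `R ≤ |Γ|`, the instance is large enough for all asymptotic bounds; `2 ≤ R` turns `2 *
  -- A.time n ≤ R` into `A.time n + 1 ≤ R`.
  set R := max n₀ 2
  obtain ⟨Γ, _, _, γ, hγ, hgen, hfree, hcard, hcard'⟩ := exists_group_freeUpTo hd R
  set n := Fintype.card Γ
  obtain ⟨⟨hAn, hTn⟩, hMn, hn3⟩ := hn₀ n ((le_max_left _ _).trans hcard)
  have hR2 : 2 ≤ R := le_max_right _ _
  have hR : A.time n + 1 ≤ R := by
    have hlogn : 0 < Real.log n := Real.log_pos (by exact_mod_cast (by omega : 1 < n))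
    have h1 : Real.log (Real.log n) ≤ 2 * R * Real.log m := by
      calc Real.log (Real.log n) ≤ Real.log (Real.log (((d + 1) ^ R).factorial : ℕ)) := by
            refine Real.log_le_log hlogn (Real.log_le_log ?_ (by exact_mod_cast hcard'))
            exact_mod_cast (by omega : 0 < n)
        _ ≤ 2 * R * Real.log (d + 1 : ℕ) := log_log_factorial_pow_le (by omega)
        _ ≤ 2 * R * Real.log m := by
            gcongr
            push_cast
            linarith
    have h2 : (A.time n : ℝ) * Real.log m ≤ (R / 2 : ℝ) * Real.log m := by linarith
    have h3 : (A.time n : ℝ) ≤ R / 2 := le_of_mul_le_mul_right h2 hlm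
    have h4 : 2 * A.time n ≤ R := by
      exact_mod_cast (by linarith : 2 * (A.time n : ℝ) ≤ R)
    omega
  have hinj := hfree.injective (by omega)
  have hne := hfree.ne_one (by omega)
  have h1 := hAn Γ (cayleyInstance γ hγ hinj hne hgen) rfl
  have h2 := successProbability_cayleyInstance_lt hd hγ hinj hne hgen hfree A hR
  have h3 := hMn ((3 * (d + 1) + 1) ^ (A.time n + 1)) (by push_cast [hm]; rfl)
  linarith
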